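/- Let $X$ be a real Banach space with dual $X^*$ (dual norm, $\langle x,w\rangle=w(x)$). Let $K_1,\dots,K_m\subset X$ be nonempty, convex and weakly compact sets (the uncertainty sets), and let $y_1,\dots,y_m\in\{-1,1\}$ be labels. Let $K_+$ be the convex hull of $\bigcup_{i:\,y_i=1}K_i$ and $K_-$ the convex hull of $\bigcup_{i:\,y_i=-1}K_i$, and assume $K_+\cap K_-=\emptyset$. Consider the robust hard-margin problem $$\text{(R-SVM)}\qquad \min_{(w,b)\in X^*\times\mathbb R}\ \tfrac12\|w\|^2\quad\text{subject to}\quad \min_{x\in K_i}y_i(\langle x,w\rangle+b)\ge 1,\qquad i=1,\dots,m.$$ Then: (1) (R-SVM) has at least one minimizer $(\bar w,\bar b)$. (2) If $X^*$ is strictly convex, then $\bar w$ is unique: any two minimizers of (R-SVM) have the same component in $X^*$. (3) A pair $(\bar w,\bar b)\in X^*\times\mathbb R$ is a minimizer of (R-SVM) if and only if there exist $\bar\lambda\in\mathbb R^m$ with $\bar\lambda_i\ge 0$ for all $i$, and $\bar x=(\bar x_1,\dots,\bar x_m)\in\prod_{i=1}^m K_i$, such that $$\max_{x\in K_i}\bigl(1-y_i(\langle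 x,\bar w\rangle+\bar b)\bigr)\le 0,\qquad i=1,\dots,m,$$ $$\bar w\in M\Bigl(\sum_{i=1}^m y_i\bar\lambda_i\bar x_i\Bigr),\qquad \sum_{i=1}^m y_i\bar\lambda_i=0,$$ $$\bar\lambda_i\bigl(1-y_i(\langle\bar x_i,\bar w\rangle+\bar b)\bigr)=0,\qquad i=1,\dots,m,$$ where $M(x)=\{f\in X^*:\langle x,f\rangle=\|x\|^2=\|f\|^2\}$ is the normalized duality mapping. -/

import Mathlib

namespace RobustSVM

noncomputable section

/-- A set of a real normed space is weakly compact: it is compact for the weak topology. -/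
def WeaklyCompact {X : Type*} [NormedAddCommGroup X] [NormedSpace ℝ X] (S : Set X) : Prop :=
  IsCompact (toWeakSpace ℝ X '' S)

/-- The convex hull of the union of the uncertainty sets `K i` whose label `y i` is `s`. It is
`K₊` for `s = 1` and `K₋` for `s = -1`. -/
def classHull {X : Type*} [NormedAddCommGroup X] [NormedSpace ℝ X] {m : ℕ}
    (y : Fin m → ℝ) (K : Fin m → Set X) (s : ℝ) : Set X :=
  convexHull ℝ (⋃ i ∈ {i : Fin m | y i = s}, K i)

/-- The normalized duality mapping: `M x` is the set of all `f` in the dual with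
`⟨x, f⟩ = ‖x‖² = ‖f‖²`. -/
def dualityMap {X : Type*} [NormedAddCommGroup X] [NormedSpace ℝ X] (x : X) :
    Set (StrongDual ℝ X) :=
  {f | f x = ‖x‖ ^ 2 ∧ ‖x‖ ^ 2 = ‖f‖ ^ 2}

/-- The objective `(w, b) ↦ ½‖w‖²` of the robust hard-margin problem. -/
def objective {X : Type*} [NormedAddCommGroup X] [NormedSpace ℝ X]
    (p : StrongDual ℝ X × ℝ) : ℝ :=
  (1 / 2) * ‖p.1‖ ^ 2

/-- The feasible set of the robust hard-margin problem: for each `i`, the minimum over `x ∈ K i` of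
`y i * (⟨x, w⟩ + b)` exists and is at least `1`. -/
def feasibleSet {X : Type*} [NormedAddCommGroup X] [NormedSpace ℝ X] {m : ℕ}
    (y : Fin m → ℝ) (K : Fin m → Set X) : Set (StrongDual ℝ X × ℝ) :=
  {p | ∀ i : Fin m, ∃ r : ℝ, IsLeast ((fun x : X => y i * (p.1 x + p.2)) '' K i) r ∧ 1 ≤ r}

/-- `p = (w, b)` is a (global) minimizer of the robust hard-margin problem. -/
def IsMinimizer {X : Type*} [NormedAddCommGroup X] [NormedSpace ℝ X] {m : ℕ}
    (y : Fin m → ℝ) (K : Fin m → Set X) (p : StrongDual ℝ X × ℝ) : Prop :=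
  p ∈ feasibleSet y K ∧ ∀ q ∈ feasibleSet y K, objective p ≤ objective q

end

end RobustSVM

namespace RobustSVM

section

variable {X : Type*} [NormedAddCommGroup X] [NormedSpace ℝ X]

/-! If both labels occur, the differences of points of the two class hulls form a convex, weakly
compact set `classDifference` that omits 0, so it has an element d of least norm δ > 0. Separating
it from the δ-ball gives w ≥ 2 on it with ‖w‖ ≤ 2/δ, and a suitable offset makes w feasible.
Rescaling the weights of d gives multipliers l and a vector s with ∑ l = ‖s‖² and ‖s‖ = 2/δ
(`exists_primal_dual_pair`). Every feasible w satisfies ‖s‖² = ∑ l ≤ w s ≤ ‖w‖‖s‖, so ‖s‖ is the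
optimal norm. All minimizers thus lie in `dualityMap s` for this one s, which gives uniqueness under
strict convexity, and equality in the chain is complementary slackness. Conversely, the optimality
conditions force ∑ l' = ‖s'‖², and the same bound applies. -/

lemma WeaklyCompact.exists_isMinOn {S : Set X} (hS : WeaklyCompact S) (hne : S.Nonempty)
    (f : StrongDual ℝ X) : ∃ a ∈ S, ∀ x ∈ S, f a ≤ f x := by
  have hc : Continuous fun x : WeakSpace ℝ X => f ((toWeakSpace ℝ X).symm x) :=
    WeakBilin.eval_continuous _ f
  obtain ⟨_, ⟨a, ha, rfl⟩, hmin⟩ := IsCompact.exists_isMinOn hS (hne.image _) hc.continuousOn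
  exact ⟨a, ha, fun x hx => by simpa using hmin (Set.mem_image_of_mem _ hx)⟩

lemma isClosed_toWeakSpace_image {S : Set X} (hS : IsClosed S) (hc : Convex ℝ S) :
    IsClosed (toWeakSpace ℝ X '' S) := by
  have h := hc.toWeakSpace_closure ℝ
  rw [hS.closure_eq] at h
  rw [h]
  exact isClosed_closure

/-- The norm is weakly lower semicontinuous: closed balls are convex, hence weakly closed. -/
lemma WeaklyCompact.exists_norm_le {S : Set X} (hS : WeaklyCompact S) (hne : S.Nonempty) :
    ∃ a ∈ S, ∀ x ∈ S, ‖a‖ ≤ ‖x‖ := by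
  have hl : LowerSemicontinuous fun x : WeakSpace ℝ X => ‖(toWeakSpace ℝ X).symm x‖ := by
    refine lowerSemicontinuous_iff_isClosed_preimage.2 fun r => ?_
    convert isClosed_toWeakSpace_image (Metric.isClosed_closedBall (x := (0 : X)) (ε := r))
      (convex_closedBall _ _) using 1
    ext x
    rw [LinearEquiv.image_eq_preimage_symm]
    simp
  obtain ⟨_, ⟨a, ha, rfl⟩, hmin⟩ :=
    LowerSemicontinuousOn.exists_isMinOn (hne.image _) hS (hl.lowerSemicontinuousOn _)
  exact ⟨a, ha, fun x hx => by simpa using hmin (Set.mem_image_of_mem _ hx)⟩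

lemma exists_dual_of_le_norm {D : Set X} (hD : Convex ℝ D) {δ c : ℝ} (hδ : 0 < δ) (hc : 0 < c)
    (h : ∀ d ∈ D, δ ≤ ‖d‖) : ∃ w : StrongDual ℝ X, (∀ d ∈ D, c ≤ w d) ∧ ‖w‖ ≤ c / δ := by
  obtain ⟨f, u, hf, hu⟩ := geometric_hahn_banach_open (convex_ball (0 : X) δ) Metric.isOpen_ball hD
    (Set.disjoint_left.2 fun d hd hd' => by
      have := h d hd'
      rw [mem_ball_zero_iff] at hd
      linarith)
  have hu0 : 0 < u := by simpa using hf 0 (Metric.mem_ball_self hδ)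
  have hle : ∀ z ∈ Metric.closedBall (0 : X) δ, f z ≤ u := by
    intro z hz
    rw [← closure_ball (0 : X) hδ.ne'] at hz
    exact closure_minimal (fun a ha => (hf a ha).le)
      (isClosed_le f.continuous continuous_const) hz
  have hnorm : ‖f‖ ≤ u / δ := by
    refine f.opNorm_le_bound (by positivity) fun z => ?_
    refine LinearMap.bound_of_ball_bound' hδ u (f : X →ₗ[ℝ] ℝ) (fun z hz => ?_) z
    refine abs_le.2 ⟨?_, hle z hz⟩
    have := hle (-z) (by simpa using hz)
    rw [map_neg] at this
    simp only [ContinuousLinearMap.coe_coe]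
    linarith
  refine ⟨(c / u) • f, fun d hd => ?_, ?_⟩
  · have := mul_le_mul_of_nonneg_left (hu d hd) (by positivity : 0 ≤ c / u)
    rwa [div_mul_cancel₀ _ hu0.ne'] at this
  · rw [norm_smul, Real.norm_of_nonneg (by positivity)]
    refine (mul_le_mul_of_nonneg_left hnorm (by positivity)).trans (le_of_eq ?_)
    field_simp

variable {m : ℕ} {y : Fin m → ℝ} {K : Fin m → Set X}

lemma mem_feasibleSet_iff (hne : ∀ i, (K i).Nonempty) (hcomp : ∀ i, WeaklyCompact (K i))
    {p : StrongDual ℝ X × ℝ} :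
    p ∈ feasibleSet y K ↔ ∀ i, ∀ x ∈ K i, 1 ≤ y i * (p.1 x + p.2) := by
  constructor
  · intro h i x hx
    obtain ⟨r, hr, h1⟩ := h i
    exact h1.trans (hr.2 (Set.mem_image_of_mem _ hx))
  · intro h i
    obtain ⟨a, ha, hmin⟩ := (hcomp i).exists_isMinOn (hne i) (y i • p.1)
    refine ⟨_, ⟨Set.mem_image_of_mem _ ha, ?_⟩, h i a ha⟩
    rintro _ ⟨x, hx, rfl⟩
    have := hmin x hx
    simp only [smul_apply, smul_eq_mul] at this
    simp only [mul_add]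
    linarith

lemma mem_feasibleSet_iff_isGreatest {w : StrongDual ℝ X} {b : ℝ} :
    (w, b) ∈ feasibleSet y K ↔
      ∀ i, ∃ r : ℝ, IsGreatest ((fun z : X => 1 - y i * (w z + b)) '' K i) r ∧ r ≤ 0 := by
  refine forall_congr' fun i => ⟨?_, ?_⟩
  · rintro ⟨_, ⟨⟨a, ha, rfl⟩, hr⟩, h1⟩
    refine ⟨_, ⟨⟨a, ha, rfl⟩, ?_⟩, by simpa using h1⟩
    rintro _ ⟨x, hx, rfl⟩
    exact sub_le_sub_left (hr (Set.mem_image_of_mem _ hx)) 1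
  · rintro ⟨_, ⟨⟨a, ha, rfl⟩, hr⟩, h1⟩
    refine ⟨_, ⟨⟨a, ha, rfl⟩, ?_⟩, by simpa using h1⟩
    rintro _ ⟨x, hx, rfl⟩
    exact sub_le_sub_iff_left 1 |>.1 (hr (Set.mem_image_of_mem _ hx))

/-! ### The set of class differences -/

/-- The weights `a` whose restriction to each of the two classes has total mass one. -/
def balancedWeights (y : Fin m → ℝ) : Set (Fin m → ℝ) :=
  {a | (∀ i, 0 ≤ a i) ∧ ∑ i, a i = 2 ∧ ∑ i, y i * a i = 0}

lemma isCompact_balancedWeights (y : Fin m → ℝ) : IsCompact (balancedWeights y) := by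
  refine (isCompact_Icc (a := (0 : Fin m → ℝ)) (b := fun _ => 2)).of_isClosed_subset ?_ ?_
  · refine IsClosed.inter (isClosed_Ici (a := (0 : Fin m → ℝ))) (IsClosed.inter ?_ ?_)
    · exact isClosed_eq (by fun_prop) continuous_const
    · exact isClosed_eq (by fun_prop) continuous_const
  · rintro a ⟨h0, h2, -⟩
    exact ⟨h0, fun i => h2 ▸ Finset.single_le_sum (fun j _ => h0 j) (Finset.mem_univ i)⟩

/-- The differences of a convex combination of points of the positive class and one of points of
the negative class. -/
def classDifference (y : Fin m → ℝ) (K : Fin m → Set X) : Set X :=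
  {d | ∃ a ∈ balancedWeights y, ∃ x : Fin m → X, (∀ i, x i ∈ K i) ∧
    ∑ i, (y i * a i) • x i = d}

/-- A continuous image of the compact product of the weights with the sets `K i`; one point per set
suffices because the sets are convex. -/
lemma weaklyCompact_classDifference (hcomp : ∀ i, WeaklyCompact (K i)) :
    WeaklyCompact (classDifference y K) := by
  have hK : IsCompact (balancedWeights y ×ˢ Set.univ.pi fun i => toWeakSpace ℝ X '' K i) :=
    (isCompact_balancedWeights y).prod (isCompact_univ_pi hcomp)
  have hcont : Continuous fun p : (Fin m → ℝ) × (Fin m → WeakSpace ℝ X) =>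
      ∑ i, (y i * p.1 i) • p.2 i := by fun_prop
  have himg := hK.image hcont
  unfold WeaklyCompact
  convert himg using 1
  ext z
  constructor
  · rintro ⟨_, ⟨a, ha, x, hx, rfl⟩, rfl⟩
    exact ⟨(a, fun i => toWeakSpace ℝ X (x i)), ⟨ha, fun i _ => Set.mem_image_of_mem _ (hx i)⟩,
      by simp⟩
  · rintro ⟨⟨a, x⟩, ⟨ha, hx⟩, rfl⟩
    choose x' hx' hxx using fun i => hx i (Set.mem_univ i)
    exact ⟨_, ⟨a, ha, x', hx', rfl⟩, by simp [hxx]⟩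

open scoped Pointwise in
lemma exists_mem_smul_add_smul {S : Set X} (hS : Convex ℝ S) {x z : X} (hx : x ∈ S) (hz : z ∈ S)
    {a b : ℝ} (ha : 0 ≤ a) (hb : 0 ≤ b) : ∃ v ∈ S, (a + b) • v = a • x + b • z := by
  have : a • x + b • z ∈ (a + b) • S := by
    rw [hS.add_smul ha hb]
    exact Set.add_mem_add (Set.smul_mem_smul_set hx) (Set.smul_mem_smul_set hz)
  exact this

lemma convex_classDifference (hconv : ∀ i, Convex ℝ (K i)) :
    Convex ℝ (classDifference y K) := by
  rintro _ ⟨a, ⟨ha0, ha2, hay⟩, x, hx, rfl⟩ _ ⟨b, ⟨hb0, hb2, hby⟩, z, hz, rfl⟩ s t hs ht hst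
  -- The two weighted points of each `K i` merge into one; this form also covers zero total weight.
  choose v hv hv' using fun i => exists_mem_smul_add_smul (hconv i) (hx i) (hz i)
    (mul_nonneg hs (ha0 i)) (mul_nonneg ht (hb0 i))
  refine ⟨fun i => s * a i + t * b i, ⟨fun i => ?_, ?_, ?_⟩, v, hv, ?_⟩
  · have := ha0 i
    have := hb0 i
    positivity
  · rw [Finset.sum_add_distrib, ← Finset.mul_sum, ← Finset.mul_sum, ha2, hb2, ← add_mul, hst,
      one_mul]
  · simp only [mul_add, mul_left_comm (y _)]
    rw [Finset.sum_add_distrib, ← Finset.mul_sum, ← Finset.mul_sum, hay, hby]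
    simp
  · simp only [mul_smul, hv', Finset.smul_sum]
    rw [← Finset.sum_add_distrib]
    refine Finset.sum_congr rfl fun i _ => ?_
    module

lemma zero_notMem_classDifference (hy : ∀ i, y i = 1 ∨ y i = -1)
    (hdisj : classHull y K 1 ∩ classHull y K (-1) = ∅) : (0 : X) ∉ classDifference y K := by
  classical
  rintro ⟨a, ⟨ha0, ha2, hay⟩, x, hx, h0⟩
  have hneg : ∀ i, ¬ y i = 1 ↔ y i = -1 := fun i => by
    rcases hy i with h | h <;> rw [h] <;> norm_num
  have hmem : ∀ s : ℝ, ∑ i with y i = s, a i = 1 →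
      ∑ i with y i = s, a i • x i ∈ classHull y K s := fun s hs =>
    (convex_convexHull ℝ _).sum_mem (fun i _ => ha0 i) hs fun i hi =>
      subset_convexHull ℝ _ (Set.mem_biUnion (Finset.mem_filter.1 hi).2 (hx i))
  rw [← Finset.sum_filter_add_sum_filter_not Finset.univ (fun i => y i = 1)] at ha2 hay h0
  simp only [hneg] at ha2 hay h0
  have e1 : ∀ s : ℝ, ∑ i with y i = s, y i * a i = s * ∑ i with y i = s, a i := fun s => by
    rw [Finset.mul_sum]
    exact Finset.sum_congr rfl fun i hi => by rw [(Finset.mem_filter.1 hi).2]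
  have e2 : ∀ s : ℝ, ∑ i with y i = s, (y i * a i) • x i = s • ∑ i with y i = s, a i • x i :=
    fun s => by
    rw [Finset.smul_sum]
    exact Finset.sum_congr rfl fun i hi => by rw [(Finset.mem_filter.1 hi).2, mul_smul]
  rw [e1, e1] at hay
  rw [e2, e2, one_smul, neg_one_smul, ← sub_eq_add_neg, sub_eq_zero] at h0
  -- Total mass 2 and signed mass 0 give each class mass 1.
  have h1 := hmem 1 (by linarith)
  have h2 := hmem (-1) (by linarith)
  rw [← h0] at h2
  exact (Set.eq_empty_iff_forall_notMem.1 hdisj _) ⟨h1, h2⟩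

lemma sub_mem_classDifference (hne : ∀ i, (K i).Nonempty) {i j : Fin m} (hi : y i = 1)
    (hj : y j = -1) {x z : X} (hx : x ∈ K i) (hz : z ∈ K j) : x - z ∈ classDifference y K := by
  classical
  have hij : i ≠ j := by
    rintro rfl
    rw [hi] at hj
    norm_num at hj
  choose v hv using hne
  refine ⟨Pi.single i 1 + Pi.single j 1, ⟨fun k => ?_, ?_, ?_⟩,
    Function.update (Function.update v i x) j z, fun k => ?_, ?_⟩
  · have h1 : (0 : Fin m → ℝ) ≤ Pi.single i 1 := Pi.single_nonneg.2 zero_le_one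
    have h2 : (0 : Fin m → ℝ) ≤ Pi.single j 1 := Pi.single_nonneg.2 zero_le_one
    exact add_nonneg (h1 k) (h2 k)
  · simp only [Pi.add_apply, Finset.sum_add_distrib, Finset.sum_pi_single', Finset.mem_univ,
      if_true]
    norm_num
  · simp [Pi.single_apply, mul_add, Finset.sum_add_distrib, hi, hj]
  · rcases eq_or_ne k j with rfl | hkj
    · simpa using hz
    · rcases eq_or_ne k i with rfl | hki
      · simpa [hkj] using hx
      · simpa [hkj, hki] using hv k
  · simp [Pi.single_apply, mul_add, add_smul, Finset.sum_add_distrib, hi, hj, hij, sub_eq_add_neg]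

/-! ### Duality -/

/-- For weights `l` that are balanced between the classes, the offset `b` drops out. -/
lemma apply_sum_smul_eq {l : Fin m → ℝ} (hl : ∑ i, y i * l i = 0) (x : Fin m → X)
    (w : StrongDual ℝ X) (b : ℝ) :
    w (∑ i, (y i * l i) • x i) = ∑ i, l i * (y i * (w (x i) + b)) := by
  have : ∑ i, l i * (y i * (w (x i) + b)) =
      ∑ i, (y i * l i) * w (x i) + (∑ i, y i * l i) * b := by
    rw [Finset.sum_mul, ← Finset.sum_add_distrib]
    exact Finset.sum_congr rfl fun i _ => by ring
  rw [this, hl, zero_mul, add_zero, map_sum]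
  simp

lemma exists_offset {w : StrongDual ℝ X} (hy : ∀ i, y i = 1 ∨ y i = -1)
    (h : ∀ i j, y i = 1 → y j = -1 → ∀ x ∈ K i, ∀ z ∈ K j, 2 ≤ w x - w z)
    (hne : ∀ i, (K i).Nonempty) (hpos : ∃ i, y i = 1) (hneg : ∃ i, y i = -1) :
    ∃ b : ℝ, ∀ i, ∀ x ∈ K i, 1 ≤ y i * (w x + b) := by
  obtain ⟨i₀, hi₀⟩ := hpos
  obtain ⟨j₀, hj₀⟩ := hneg
  obtain ⟨x₀, hx₀⟩ := hne i₀
  obtain ⟨z₀, hz₀⟩ := hne j₀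
  obtain ⟨b, hb, hb'⟩ := exists_between_of_forall_le
    (s := {r | ∃ i, y i = 1 ∧ ∃ x ∈ K i, 1 - w x = r})
    (t := {r | ∃ j, y j = -1 ∧ ∃ z ∈ K j, -1 - w z = r})
    ⟨_, i₀, hi₀, x₀, hx₀, rfl⟩ ⟨_, j₀, hj₀, z₀, hz₀, rfl⟩ (by
      rintro _ ⟨i, hi, x, hx, rfl⟩ _ ⟨j, hj, z, hz, rfl⟩
      have := h i j hi hj x hx z hz
      linarith)
  refine ⟨b, fun i x hx => ?_⟩
  rcases hy i with hi | hi
  · have := hb ⟨i, hi, x, hx, rfl⟩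
    rw [hi]
    linarith
  · have := hb' ⟨i, hi, x, hx, rfl⟩
    rw [hi]
    linarith

/-- Strong duality: a feasible point and multipliers with matching values. -/
theorem exists_primal_dual_pair (hy : ∀ i, y i = 1 ∨ y i = -1) (hne : ∀ i, (K i).Nonempty)
    (hconv : ∀ i, Convex ℝ (K i)) (hcomp : ∀ i, WeaklyCompact (K i))
    (hdisj : classHull y K 1 ∩ classHull y K (-1) = ∅) :
    ∃ (p : StrongDual ℝ X × ℝ) (l : Fin m → ℝ) (x : Fin m → X), p ∈ feasibleSet y K ∧
      (∀ i, 0 ≤ l i) ∧ (∀ i, x i ∈ K i) ∧ ∑ i, y i * l i = 0 ∧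
      ∑ i, l i = ‖∑ i, (y i * l i) • x i‖ ^ 2 ∧ ‖p.1‖ ≤ ‖∑ i, (y i * l i) • x i‖ := by
  -- With a single class there are no differences: w = 0, with the common label as offset, is
  -- optimal.
  by_cases hone : ∃ s : ℝ, ∀ i, y i = s
  · obtain ⟨s, hs⟩ := hone
    choose v hv using hne
    refine ⟨(0, s), 0, v, (mem_feasibleSet_iff (fun i => ⟨v i, hv i⟩) hcomp).2 ?_, by simp, hv,
      by simp, by simp, by simp⟩
    intro i x _
    rcases hy i with h | h <;> simp [← hs i, h]
  have hpos : ∃ i, y i = 1 := by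
    by_contra! h
    exact hone ⟨-1, fun i => (hy i).resolve_left (h i)⟩
  have hneg : ∃ i, y i = -1 := by
    by_contra! h
    exact hone ⟨1, fun i => (hy i).resolve_right (h i)⟩
  have hDne : (classDifference y K).Nonempty := by
    obtain ⟨i, hi⟩ := hpos
    obtain ⟨j, hj⟩ := hneg
    obtain ⟨x, hx⟩ := hne i
    obtain ⟨z, hz⟩ := hne j
    exact ⟨_, sub_mem_classDifference hne hi hj hx hz⟩
  obtain ⟨d, hd, hmin⟩ := (weaklyCompact_classDifference hcomp).exists_norm_le hDne
  have hd0 : 0 < ‖d‖ := norm_pos_iff.2 fun h =>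
    zero_notMem_classDifference hy hdisj (h ▸ hd)
  obtain ⟨w, hw, hwn⟩ := exists_dual_of_le_norm (convex_classDifference hconv) hd0 two_pos hmin
  obtain ⟨b, hb⟩ := exists_offset hy (fun i j hi hj x hx z hz => by
    simpa using hw _ (sub_mem_classDifference hne hi hj hx hz)) hne hpos hneg
  obtain ⟨a, ⟨ha0, ha2, hay⟩, x, hx, hxd⟩ := hd
  -- The factor 2/‖d‖² makes the total mass 4/‖d‖² equal to the squared norm of the rescaled vector.
  have hs : ∑ i, (y i * (2 / ‖d‖ ^ 2 * a i)) • x i = (2 / ‖d‖ ^ 2) • d := by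
    rw [← hxd, Finset.smul_sum]
    exact Finset.sum_congr rfl fun i _ => by rw [smul_smul, mul_left_comm]
  have hsn : ‖(2 / ‖d‖ ^ 2) • d‖ = 2 / ‖d‖ := by
    rw [norm_smul, Real.norm_of_nonneg (by positivity)]
    field_simp
  refine ⟨(w, b), fun i => 2 / ‖d‖ ^ 2 * a i, x, (mem_feasibleSet_iff hne hcomp).2 hb,
    fun i => mul_nonneg (by positivity) (ha0 i), hx, ?_, ?_, ?_⟩
  · simp only [mul_left_comm (y _)]
    rw [← Finset.mul_sum, hay, mul_zero]
  · rw [hs, hsn, ← Finset.mul_sum, ha2]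
    field_simp
  · rw [hs, hsn]
    exact hwn

lemma sum_le_apply_sum_smul {l : Fin m → ℝ} (hl : ∑ i, y i * l i = 0) (hl0 : ∀ i, 0 ≤ l i)
    {x : Fin m → X} {w : StrongDual ℝ X} {b : ℝ} (h : ∀ i, 1 ≤ y i * (w (x i) + b)) :
    ∑ i, l i ≤ w (∑ i, (y i * l i) • x i) := by
  rw [apply_sum_smul_eq hl x w b]
  exact Finset.sum_le_sum fun i _ => le_mul_of_one_le_right (hl0 i) (h i)

lemma norm_le_of_sq_le_apply {w : StrongDual ℝ X} {s : X} (h : ‖s‖ ^ 2 ≤ w s) : ‖s‖ ≤ ‖w‖ := by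
  rcases (norm_nonneg s).eq_or_lt with h0 | h0
  · rw [← h0]
    exact norm_nonneg w
  · have := h.trans ((le_abs_self _).trans (w.le_opNorm s))
    rw [sq] at this
    exact le_of_mul_le_mul_right this h0

lemma objective_le_iff {p q : StrongDual ℝ X × ℝ} : objective p ≤ objective q ↔ ‖p.1‖ ≤ ‖q.1‖ := by
  unfold objective
  rw [mul_le_mul_iff_right₀ (by norm_num), sq_le_sq₀ (norm_nonneg _) (norm_nonneg _)]

lemma eq_of_mem_dualityMap [StrictConvexSpace ℝ (StrongDual ℝ X)] {s : X} {f g : StrongDual ℝ X}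
    (hf : f ∈ dualityMap s) (hg : g ∈ dualityMap s) : f = g := by
  have hfn : ‖s‖ = ‖f‖ := (sq_eq_sq₀ (norm_nonneg _) (norm_nonneg _)).1 hf.2
  have hgn : ‖s‖ = ‖g‖ := (sq_eq_sq₀ (norm_nonneg _) (norm_nonneg _)).1 hg.2
  refine eq_of_norm_eq_of_norm_add_eq (hfn.symm.trans hgn) (le_antisymm (norm_add_le _ _) ?_)
  -- The midpoint also takes the value ‖s‖² at s, so its norm cannot drop.
  have h : ‖s‖ ≤ ‖(1 / 2 : ℝ) • (f + g)‖ := norm_le_of_sq_le_apply (by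
    simp only [smul_apply, add_apply, hf.1, hg.1,
      smul_eq_mul]
    linarith)
  rw [norm_smul, Real.norm_of_nonneg (by norm_num)] at h
  linarith

end

end RobustSVM

theorem theorem1 {X : Type*} [NormedAddCommGroup X] [NormedSpace ℝ X] [CompleteSpace X]
    {m : ℕ} (y : Fin m → ℝ) (hy : ∀ i, y i = 1 ∨ y i = -1)
    (K : Fin m → Set X) (hne : ∀ i, (K i).Nonempty)
    (hconv : ∀ i, Convex ℝ (K i)) (hcomp : ∀ i, RobustSVM.WeaklyCompact (K i))
    (hdisj : RobustSVM.classHull y K 1 ∩ RobustSVM.classHull y K (-1) = ∅) :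
    (∃ p : StrongDual ℝ X × ℝ, RobustSVM.IsMinimizer y K p) ∧
    (StrictConvexSpace ℝ (StrongDual ℝ X) →
      ∀ p q : StrongDual ℝ X × ℝ, RobustSVM.IsMinimizer y K p → RobustSVM.IsMinimizer y K q →
        p.1 = q.1) ∧
    (∀ (w : StrongDual ℝ X) (b : ℝ),
      RobustSVM.IsMinimizer y K (w, b) ↔
        ∃ (l : Fin m → ℝ) (x : Fin m → X),
          (∀ i, 0 ≤ l i) ∧ (∀ i, x i ∈ K i) ∧
          (∀ i, ∃ r : ℝ, IsGreatest ((fun z : X => 1 - y i * (w z + b)) '' K i) r ∧ r ≤ 0) ∧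
          w ∈ RobustSVM.dualityMap (∑ i, (y i * l i) • x i) ∧
          (∑ i, y i * l i = 0) ∧
          (∀ i, l i * (1 - y i * (w (x i) + b)) = 0)) := by
  obtain ⟨p₀, l, x, hp₀, hl0, hx, hl, hsum, hnorm⟩ :=
    RobustSVM.exists_primal_dual_pair hy hne hconv hcomp hdisj
  have hfeas {p : StrongDual ℝ X × ℝ} :=
    RobustSVM.mem_feasibleSet_iff (y := y) (p := p) hne hcomp
  set s := ∑ i, (y i * l i) • x i
  have hlow : ∀ p ∈ RobustSVM.feasibleSet y K, ‖s‖ ^ 2 ≤ p.1 s := fun p hp =>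
    hsum ▸ RobustSVM.sum_le_apply_sum_smul hl hl0 fun i => hfeas.1 hp i (x i) (hx i)
  have hmem : ∀ p, RobustSVM.IsMinimizer y K p → p.1 ∈ RobustSVM.dualityMap s := fun p hp => by
    have h1 : ‖p.1‖ ≤ ‖s‖ := (RobustSVM.objective_le_iff.1 (hp.2 p₀ hp₀)).trans hnorm
    have h2 := hlow p hp.1
    have h3 : p.1 s ≤ ‖s‖ ^ 2 := by
      rw [sq]
      exact (le_abs_self _).trans (p.1.le_of_opNorm_le h1 s)
    exact ⟨le_antisymm h3 h2, by rw [le_antisymm h1 (RobustSVM.norm_le_of_sq_le_apply h2)]⟩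
  refine ⟨⟨p₀, hp₀, fun q hq => RobustSVM.objective_le_iff.2
    (hnorm.trans (RobustSVM.norm_le_of_sq_le_apply (hlow q hq)))⟩, fun _ p q hp hq =>
    RobustSVM.eq_of_mem_dualityMap (hmem p hp) (hmem q hq), fun w b => ⟨fun h => ?_, ?_⟩⟩
  · have hw := hmem _ h
    refine ⟨l, x, hl0, hx, RobustSVM.mem_feasibleSet_iff_isGreatest.1 h.1, hw, hl, ?_⟩
    -- There is no duality gap, and each term is nonnegative, so each vanishes.
    have h0 : ∑ i, l i * (y i * (w (x i) + b) - 1) = 0 := by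
      simp only [mul_sub, mul_one]
      rw [Finset.sum_sub_distrib, ← RobustSVM.apply_sum_smul_eq hl x w b, hsum, ← hw.1, sub_self]
    rw [Finset.sum_eq_zero_iff_of_nonneg fun i _ =>
      mul_nonneg (hl0 i) (sub_nonneg.2 (hfeas.1 h.1 i (x i) (hx i)))] at h0
    intro i
    linarith [h0 i (Finset.mem_univ i)]
  · rintro ⟨l', x', hl0', hx', hgr, hw, hl', hcs⟩
    have hsum' : ∑ i, l' i = ‖∑ i, (y i * l' i) • x' i‖ ^ 2 := by
      rw [← hw.1, RobustSVM.apply_sum_smul_eq hl' x' w b]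
      exact Finset.sum_congr rfl fun i _ => by linarith [hcs i]
    refine ⟨RobustSVM.mem_feasibleSet_iff_isGreatest.2 hgr, fun q hq =>
      RobustSVM.objective_le_iff.2 ?_⟩
    rw [← (sq_eq_sq₀ (norm_nonneg _) (norm_nonneg _)).1 hw.2]
    exact RobustSVM.norm_le_of_sq_le_apply (hsum' ▸
      RobustSVM.sum_le_apply_sum_smul hl' hl0' fun i => hfeas.1 hq i (x' i) (hx' i))
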